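/- Let $l,m\in\mathbb{N}_+$, let $A\subset\mathbb{R}^l$ be a nonempty Borel set, and let $\mathbb{Q}(v)$, $v\in A$, be probability measures on a measurable space $(\Omega_1,\mathcal{F}_1)$. Let $r:A\times\Omega_1\to\mathbb{R}^m$ be measurable with respect to $\mathcal{B}(A)\otimes\mathcal{F}_1$ and such that $\mathbb{E}_{\mathbb{Q}(v)}(r(v,\cdot))=0$ for every $v\in A$, and put $\Sigma(v)=\mathbb{E}_{\mathbb{Q}(v)}\big(r(v,\cdot)r(v,\cdot)^T\big)$ for those $v \in A$ for which this is well defined. Let $n_k\in\mathbb{N}_+$, $k\in\mathbb{N}_+$, let $b_k$, $k\in\mathbb{N}$, be $A$-valued random variables and $\chi_{k,i}$, $k\in\mathbb{N}_+$, $i=1,\dots,n_k$, be $\Omega_1$-valued random variables, all defined on one probability space. Assume that: 1. for each $k\in\mathbb{N}_+$, the variables $\chi_{k,i}$, $i=1,\dots,n_k$, are conditionally independent given $b_{k-1}$, and each of them has conditional distribution $\mathbb{Q}(v)$ given $b_{k-1}=v$; 2. $n_k\to\infty$ as $k\to\infty$; 3. $b_k\to b^*$ in probability for some $b^*\in A$;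 4. for some Borel set $B\subset A$ which is a neighbourhood of $b^*$ in $A$, $$\lim_{M\to\infty}\ \sup_{v\in B}\ \mathbb{E}_{\mathbb{Q}(v)}\big(|r(v,\cdot)|^2\,\mathbb{1}(|r(v,\cdot)|^2>M)\big)=0$$ (so that $\Sigma(v)$ is well defined and finite for all $v\in B$); 5. the map $v\in B\mapsto\Sigma(v)\in\mathbb{R}^{m\times m}$ is continuous at $b^*$. Then, as $k\to\infty$, $$\frac{1}{\sqrt{n_k}}\sum_{i=1}^{n_k}r(b_{k-1},\chi_{k,i})\ \Rightarrow\ \mathcal{N}(0,\Sigma(b^*)),$$ where $\Rightarrow$ denotes convergence in distribution and $\mathcal{N}(0,\Sigma(b^*))$ is the (possibly degenerate) centred Gaussian law on $\mathbb{R}^m$ with covariance matrix $\Sigma(b^*)$. -/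

import Mathlib

open MeasureTheory ProbabilityTheory Filter Topology
open scoped ENNReal

noncomputable section

/-- The σ-algebra `σ(Y)` generated by a random variable `Y`. -/
abbrev sigmaOf {Ω S : Type*} [MeasurableSpace S] (Y : Ω → S) : MeasurableSpace Ω :=
  MeasurableSpace.comap Y inferInstance

/-- `X` has conditional distribution `Q v` given `Y = v`: the random measure `ω ↦ Q (Y ω)` is
`σ(Y)`-measurable, and `Q (Y ·) C` is a version of `P(X ∈ C | σ(Y))` for every measurable `C`. -/
structure HasCondLawGiven {Ω S E : Type*} [MeasurableSpace Ω] [MeasurableSpace S]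
    [MeasurableSpace E] (μ : Measure Ω) (X : Ω → E) (Y : Ω → S) (Q : S → Measure E) : Prop where
  measurable_law : Measurable[sigmaOf Y] (fun ω => Q (Y ω))
  condProb_eq : ∀ C : Set E, MeasurableSet C →
    μ⟦X ⁻¹' C | sigmaOf Y⟧ =ᵐ[μ] fun ω => (Q (Y ω)).real C

/-- The finite family `X` is conditionally independent given `Y`. (Mathlib's
`ProbabilityTheory.iCondIndepFun` is only available on a standard Borel sample space; this is the
usual definition, valid on any probability space.) -/
def CondIndepGiven {Ω S E ι : Type*} [MeasurableSpace Ω] [MeasurableSpace S]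
    [MeasurableSpace E] (μ : Measure Ω) (X : ι → Ω → E) (Y : Ω → S) : Prop :=
  ∀ (s : Finset ι) (C : ι → Set E), (∀ i ∈ s, MeasurableSet (C i)) →
    μ⟦⋂ i ∈ s, X i ⁻¹' C i | sigmaOf Y⟧ =ᵐ[μ] ∏ i ∈ s, μ⟦X i ⁻¹' C i | sigmaOf Y⟧

/-- Multi-stage sampling with stage sizes `n (k + 1)`: the variables `χ (k + 1) i`, `i < n (k + 1)`,
of stage `k + 1` are conditionally independent given the parameter `b k` of the preceding stage
and have conditional distribution `Q v` given `b k = v`. Stages are numbered from `1` on (the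
entries `n 0` and `χ 0` are not used), parameters from `0` on. -/
structure MultiStageSample {Ω S E : Type*} [MeasurableSpace Ω] [MeasurableSpace S]
    [MeasurableSpace E] (μ : Measure Ω) (Q : S → Measure E) (b : ℕ → Ω → S) (n : ℕ → ℕ)
    (χ : (k : ℕ) → Fin (n k) → Ω → E) : Prop where
  condIndep : ∀ k, CondIndepGiven μ (χ (k + 1)) (b k)
  condLaw : ∀ k i, HasCondLawGiven μ (χ (k + 1) i) (b k) Q

/-- `f(b, M) = E_{Q(b)} (|u(b, ·)| 1(|u(b, ·)| > M))`, with values in `[0, ∞]`. -/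
def tailMean {S E : Type*} [MeasurableSpace E] (Q : S → Measure E) (u : S → E → ℝ)
    (b : S) (M : ℝ) : ℝ≥0∞ :=
  ∫⁻ x, {x | M < |u b x|}.indicator (fun x => ENNReal.ofReal |u b x|) x ∂(Q b)

/-- `sup_{b ∈ B} f(b, M) → 0` as `M → ∞`: the laws of `u(b, ·)` under `Q(b)`, `b ∈ B`, are
uniformly integrable. -/
def UniformlyIntegrableOver {S E : Type*} [MeasurableSpace E] (Q : S → Measure E)
    (u : S → E → ℝ) (B : Set S) : Prop :=
  Tendsto (fun M : ℝ => ⨆ b ∈ B, tailMean Q u b M) atTop (𝓝 0)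

/-- The matrix `Σ(b) = E_{Q(b)} (r(b, ·) r(b, ·)ᵀ)`. -/
def secondMomentMatrix {S E : Type*} [MeasurableSpace E] {m : ℕ} (Q : S → Measure E)
    (r : S → E → EuclideanSpace ℝ (Fin m)) (b : S) : Matrix (Fin m) (Fin m) ℝ :=
  Matrix.of fun i j => ∫ x, r b x i * r b x j ∂(Q b)

end

/-! ### The joint law of a conditionally independent sample and its parameter -/

/-! By Lévy's continuity theorem it suffices that characteristic functions converge at each `t`.
Given `b k = v`, the summands are i.i.d., so the conditional characteristic function of the
normalized sum is `G k v = φ ^ n (k + 1)`, where `φ` is the characteristic function under `Q v` of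
one summand divided by `√(n (k + 1))`; hence the unconditional one is the mean of `G k (b k)`
(`CondIndepGiven.integral_prod_eq`).

A second order expansion of `φ`, with an error uniform over `v ∈ B` by uniform integrability, and
continuity of the second moments at `bstar` give convergence of `G k v` to the Gaussian value as `k
→ ∞` and `v → bstar` jointly (`tendsto_integral_exp_pow`). As `‖G k v‖ ≤ 1` and `b k → bstar` in
probability, the means converge too (`TendstoInMeasure.tendsto_integral_comp`). -/

lemma Measurable.measure_pi_const {α E ι : Type*} [MeasurableSpace α] [MeasurableSpace E]
    [Fintype ι] {κ : α → Measure E} [∀ a, IsProbabilityMeasure (κ a)] (hκ : Measurable κ) :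
    Measurable fun a => Measure.pi fun _ : ι => κ a := by
  refine Measurable.measure_of_isPiSystem_of_isProbabilityMeasure generateFrom_pi.symm
    isPiSystem_pi ?_
  rintro _ ⟨C, hC, rfl⟩
  simp only [Measure.pi_pi]
  exact Finset.measurable_prod _ fun i _ =>
    (Measure.measurable_coe (hC i (Set.mem_univ i))).comp hκ

section JointLaw

variable {Ω S E ι : Type*} [MeasurableSpace Ω] [MeasurableSpace S] [MeasurableSpace E]
  [Fintype ι] {μ : Measure Ω} [IsProbabilityMeasure μ] {Q : S → Measure E}
  [∀ v, IsProbabilityMeasure (Q v)] {Y : Ω → S} {X : ι → Ω → E}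

lemma CondIndepGiven.measure_inter_eq (hY : Measurable Y) (hX : ∀ i, Measurable (X i))
    (hQY : Measurable fun ω => Q (Y ω)) (hind : CondIndepGiven μ X Y)
    (hlaw : ∀ i, HasCondLawGiven μ (X i) Y Q) {T : Set S} (hT : MeasurableSet T)
    {C : ι → Set E} (hC : ∀ i, MeasurableSet (C i)) :
    μ (Y ⁻¹' T ∩ ⋂ i, X i ⁻¹' C i) = ∫⁻ ω in Y ⁻¹' T, ∏ i, Q (Y ω) (C i) ∂μ := by
  have hle : sigmaOf Y ≤ (inferInstance : MeasurableSpace Ω) := hY.comap_le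
  have hcap : MeasurableSet (⋂ i, X i ⁻¹' C i) := MeasurableSet.iInter fun i => hX i (hC i)
  have hmeas : Measurable fun ω => ∏ i, Q (Y ω) (C i) :=
    Finset.measurable_prod _ fun i _ => (Measure.measurable_coe (hC i)).comp hQY
  have hle1 : ∀ ω, ∏ i, Q (Y ω) (C i) ≤ 1 := fun ω =>
    Finset.prod_le_one' fun i _ => prob_le_one
  have hae : μ⟦⋂ i, X i ⁻¹' C i | sigmaOf Y⟧ =ᵐ[μ] fun ω => (∏ i, Q (Y ω) (C i)).toReal := by
    have h1 := hind Finset.univ C fun i _ => hC i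
    simp only [Finset.mem_univ, Set.iInter_true] at h1
    have h2 : ∀ᵐ ω ∂μ, ∀ i, (μ⟦X i ⁻¹' C i | sigmaOf Y⟧) ω = (Q (Y ω)).real (C i) :=
      ae_all_iff.2 fun i => (hlaw i).condProb_eq (C i) (hC i)
    filter_upwards [h1, h2] with ω h1 h2
    rw [h1, Finset.prod_apply, ENNReal.toReal_prod]
    exact Finset.prod_congr rfl fun i _ => h2 i
  have hint := setIntegral_condExp (μ := μ) (f := (⋂ i, X i ⁻¹' C i).indicator fun _ => (1 : ℝ))
    hle ((integrable_const 1).indicator hcap) (s := Y ⁻¹' T) ⟨T, hT, rfl⟩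
  rw [setIntegral_congr_ae (hY hT) (hae.mono fun ω h _ => h), setIntegral_indicator hcap,
    integral_toReal hmeas.aemeasurable
      (Eventually.of_forall fun ω => (hle1 ω).trans_lt ENNReal.one_lt_top)] at hint
  simp only [integral_const, smul_eq_mul, mul_one, Measure.real, Measure.restrict_apply_univ]
    at hint
  refine ((ENNReal.toReal_eq_toReal_iff' ?_ (measure_ne_top _ _)).1 hint).symm
  refine ((lintegral_mono hle1).trans_lt ?_).ne
  simp

/-- Both laws agree on sets `T ×ˢ box`, and boxes form a generating π-system. The kernel lives on
`Ω` rather than `S` because only `ω ↦ Q (Y ω)`, not `Q` itself, is known to be measurable. -/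
lemma CondIndepGiven.map_prodMk_eq (hY : Measurable Y) (hX : ∀ i, Measurable (X i))
    (hQY : Measurable fun ω => Q (Y ω)) (hind : CondIndepGiven μ X Y)
    (hlaw : ∀ i, HasCondLawGiven μ (X i) Y Q) :
    μ.map (fun ω => (Y ω, fun i => X i ω)) =
      (Kernel.deterministic Y hY ×ₖ
        (⟨fun ω => Measure.pi fun _ : ι => Q (Y ω), hQY.measure_pi_const⟩ : Kernel Ω (ι → E)))
        ∘ₘ μ := by
  set κ : Kernel Ω (ι → E) := ⟨fun ω => Measure.pi fun _ : ι => Q (Y ω), hQY.measure_pi_const⟩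
  have hκ : ∀ ω, κ ω = Measure.pi fun _ : ι => Q (Y ω) := fun ω => rfl
  have : IsMarkovKernel κ := ⟨fun ω => by rw [hκ]; infer_instance⟩
  have hXm : Measurable fun ω => (fun i => X i ω) := measurable_pi_lambda _ hX
  have : IsProbabilityMeasure (μ.map fun ω => (Y ω, fun i => X i ω)) :=
    Measure.isProbabilityMeasure_map (hY.prodMk hXm).aemeasurable
  refine Measure.ext_prod fun {T D} hT hD => ?_
  rw [Measure.map_apply (hY.prodMk hXm) (hT.prod hD), Measure.bind_apply (hT.prod hD)
    (Kernel.aemeasurable _)]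
  -- For fixed `T` both sides become finite measures in `D`, to be compared on boxes only.
  have hR : ∀ D : Set (ι → E), MeasurableSet D →
      ∫⁻ ω, (Kernel.deterministic Y hY ×ₖ κ) ω (T ×ˢ D) ∂μ
        = (κ ∘ₘ μ.restrict (Y ⁻¹' T)) D := by
    intro D hD
    rw [Measure.bind_apply hD (Kernel.aemeasurable _), ← lintegral_indicator (hY hT)]
    refine lintegral_congr fun ω => ?_
    rw [Kernel.prod_apply_prod, Kernel.deterministic_apply' _ _ hT]
    by_cases h : Y ω ∈ T <;> simp [Set.indicator, h]
  have hL : μ ((fun ω => (Y ω, fun i => X i ω)) ⁻¹' T ×ˢ D)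
      = (μ.restrict (Y ⁻¹' T)).map (fun ω i => X i ω) D := by
    rw [Measure.map_apply hXm hD, Measure.restrict_apply (hXm hD), Set.inter_comm]
    rfl
  rw [hL, hR D hD]
  congr 1
  have hbox : ∀ C : ι → Set E, (∀ i, MeasurableSet (C i)) →
      (μ.restrict (Y ⁻¹' T)).map (fun ω i => X i ω) (Set.univ.pi C)
        = (κ ∘ₘ μ.restrict (Y ⁻¹' T)) (Set.univ.pi C) := by
    intro C hC
    have hm := MeasurableSet.univ_pi hC
    rw [Measure.map_apply hXm hm, Measure.restrict_apply (hXm hm),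
      Measure.bind_apply hm (Kernel.aemeasurable _)]
    simp only [hκ, Measure.pi_pi]
    rw [← hind.measure_inter_eq hY hX hQY hlaw hT hC, Set.inter_comm]
    congr 2
    ext ω
    simp
  refine ext_of_generate_finite _ generateFrom_pi.symm isPiSystem_pi ?_ ?_
  · rintro _ ⟨C, hC, rfl⟩
    exact hbox C fun i => hC i (Set.mem_univ i)
  · simpa using hbox (fun _ => Set.univ) fun _ => MeasurableSet.univ

lemma CondIndepGiven.integral_prod_eq (hY : Measurable Y) (hX : ∀ i, Measurable (X i))
    (hQY : Measurable fun ω => Q (Y ω)) (hind : CondIndepGiven μ X Y)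
    (hlaw : ∀ i, HasCondLawGiven μ (X i) Y Q) {f : S → E → ℂ}
    (hf : Measurable fun p : S × E => f p.1 p.2) (hf1 : ∀ v x, ‖f v x‖ ≤ 1) :
    ∫ ω, ∏ i, f (Y ω) (X i ω) ∂μ = ∫ ω, (∫ x, f (Y ω) x ∂Q (Y ω)) ^ Fintype.card ι ∂μ := by
  have hXm : Measurable fun ω => (fun i => X i ω) := measurable_pi_lambda _ hX
  have hF : Measurable fun p : S × (ι → E) => ∏ i, f p.1 (p.2 i) :=
    Finset.measurable_prod _ fun i _ => hf.comp
      (measurable_fst.prodMk ((measurable_pi_apply i).comp measurable_snd))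
  have hF1 : ∀ p : S × (ι → E), ‖∏ i, f p.1 (p.2 i)‖ ≤ 1 := fun p =>
    (Finset.norm_prod_le _ _).trans (Finset.prod_le_one (fun _ _ => norm_nonneg _)
      fun i _ => hf1 _ _)
  have hmap := hind.map_prodMk_eq hY hX hQY hlaw
  set κ : Kernel Ω (ι → E) := ⟨fun ω => Measure.pi fun _ : ι => Q (Y ω), hQY.measure_pi_const⟩
  have hκ : ∀ ω, κ ω = Measure.pi fun _ : ι => Q (Y ω) := fun ω => rfl
  have : IsMarkovKernel κ := ⟨fun ω => by rw [hκ]; infer_instance⟩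
  have h1 : ∫ ω, ∏ i, f (Y ω) (X i ω) ∂μ
      = ∫ p, ∏ i, f p.1 (p.2 i) ∂μ.map (fun ω => (Y ω, fun i => X i ω)) :=
    (integral_map (hY.prodMk hXm).aemeasurable hF.aestronglyMeasurable).symm
  rw [h1, hmap, Measure.comp_eq_comp_const_apply, Kernel.integral_comp, Kernel.const_apply]
  · refine integral_congr_ae (Eventually.of_forall fun ω => ?_)
    simp only
    rw [Kernel.prod_apply, Kernel.deterministic_apply, Measure.dirac_prod,
      integral_map measurable_prodMk_left.aemeasurable hF.aestronglyMeasurable, hκ]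
    simp only
    rw [integral_fintype_prod_eq_prod (μ := fun _ : ι => Q (Y ω)) (fun _ x => f (Y ω) x)]
    simp
  · rw [← Measure.comp_eq_comp_const_apply, ← hmap]
    have := Measure.isProbabilityMeasure_map (μ := μ) (hY.prodMk hXm).aemeasurable
    exact Integrable.of_bound hF.aestronglyMeasurable 1 (Eventually.of_forall hF1)

lemma measurable_integral_comp_pow (hY : Measurable Y) (hQY : Measurable fun ω => Q (Y ω))
    {f : S → E → ℂ} (hf : Measurable fun p : S × E => f p.1 p.2) (N : ℕ) :
    Measurable fun ω => (∫ x, f (Y ω) x ∂Q (Y ω)) ^ N := by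
  let κ : Kernel Ω E := ⟨fun ω => Q (Y ω), hQY⟩
  have : IsMarkovKernel κ := ⟨fun ω => inferInstanceAs (IsProbabilityMeasure (Q (Y ω)))⟩
  have h : StronglyMeasurable (Function.uncurry fun ω x => f (Y ω) x) :=
    (hf.comp ((hY.comp measurable_fst).prodMk measurable_snd)).stronglyMeasurable
  exact (h.integral_kernel_prod_right (κ := κ)).measurable.pow_const N

end JointLaw

/-! ### Second order expansion of characteristic functions -/

/-- The quadratic bound serves the tail, where only second moments are available; the cubic one
serves the truncated part. For `|y| ≤ 1` both come from the series remainder, for `|y| ≥ 1` from the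
triangle inequality. -/
lemma norm_exp_I_mul_sub_taylor_le_sq_and_cube (y : ℝ) :
    ‖Complex.exp (Complex.I * y) - (1 + Complex.I * y - (y : ℂ) ^ 2 / 2)‖ ≤ 4 * y ^ 2 ∧
    ‖Complex.exp (Complex.I * y) - (1 + Complex.I * y - (y : ℂ) ^ 2 / 2)‖ ≤ 4 * |y| ^ 3 := by
  have hI : ‖Complex.I * (y : ℂ)‖ = |y| := by simp
  have hy0 := abs_nonneg y
  rw [← sq_abs y]
  rcases le_total |y| 1 with hy | hy
  · have h := Complex.exp_bound (x := Complex.I * y) (by rw [hI]; exact hy) (n := 3) (by norm_num)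
    have he : ∑ m ∈ Finset.range 3, (Complex.I * (y : ℂ)) ^ m / (m.factorial : ℂ)
        = 1 + Complex.I * y - (y : ℂ) ^ 2 / 2 := by
      simp [Finset.sum_range_succ, mul_pow, Nat.factorial]
      ring
    rw [he, hI] at h
    have hc : |y| ^ 3 * (((3 : ℕ).succ : ℝ) * (((3 : ℕ).factorial : ℝ) * (3 : ℕ))⁻¹) ≤ |y| ^ 3 := by
      refine mul_le_of_le_one_right (by positivity) ?_
      norm_num [Nat.factorial]
    have h3 : |y| ^ 3 ≤ |y| ^ 2 := pow_le_pow_of_le_one hy0 hy (by norm_num)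
    have : 0 ≤ |y| ^ 3 := by positivity
    constructor <;> linarith
  · have h : ‖Complex.exp (Complex.I * y) - (1 + Complex.I * y - (y : ℂ) ^ 2 / 2)‖
        ≤ 1 + (1 + |y| + |y| ^ 2 / 2) := by
      refine (norm_sub_le _ _).trans (add_le_add (Complex.norm_exp_I_mul_ofReal y).le ?_)
      refine (norm_sub_le _ _).trans (add_le_add ((norm_add_le _ _).trans ?_) ?_)
      · simp
      · simp
    have h2 : |y| ≤ |y| ^ 2 := le_self_pow₀ hy (by norm_num)
    have h3 : |y| ^ 2 ≤ |y| ^ 3 := pow_le_pow_right₀ hy (by norm_num)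
    constructor <;> linarith

/-- The linear term vanishes by centring, and `N * a ^ 2 = 1` for `a = (√N)⁻¹` makes the quadratic
term independent of `N`. The remainder is split at `‖g x‖ ^ 2 = M`: the cubic bound below this level
leaves a factor `a`, which tends to zero for fixed `M`. -/
lemma norm_integral_exp_sub_taylor_le {E V : Type*} [MeasurableSpace E] [NormedAddCommGroup V]
    [InnerProductSpace ℝ V] (ν : Measure E) [IsProbabilityMeasure ν] {g : E → V}
    (hg : AEStronglyMeasurable g ν) (hg2 : Integrable (fun x => ‖g x‖ ^ 2) ν) (t : V)
    (hg0 : ∫ x, inner ℝ (g x) t ∂ν = 0) {M : ℝ} {N : ℕ} (hN : 0 < N) :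
    ‖(N : ℂ) * (∫ x, Complex.exp (Complex.I * ((√N)⁻¹ * inner ℝ (g x) t : ℝ)) ∂ν - 1)
        + ((∫ x, (inner ℝ (g x) t) ^ 2 ∂ν : ℝ) : ℂ) / 2‖
      ≤ 4 * ‖t‖ ^ 2 * ∫ x, {x | M < ‖g x‖ ^ 2}.indicator (fun x => ‖g x‖ ^ 2) x ∂ν
        + 4 * ‖t‖ ^ 3 * √M ^ 3 * (√N)⁻¹ := by
  set a : ℝ := (√N)⁻¹ with ha
  have hN' : (0 : ℝ) < N := by exact_mod_cast hN
  have ha0 : 0 < a := by positivity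
  have haN : (N : ℝ) * a ^ 2 = 1 := by
    rw [ha, inv_pow, Real.sq_sqrt hN'.le, mul_inv_cancel₀ hN'.ne']
  have hgn : MemLp g 2 ν := (memLp_two_iff_integrable_sq_norm hg).2 hg2
  have hu : MemLp (fun x => inner ℝ (g x) t) 2 ν :=
    hgn.of_le_mul (c := ‖t‖) (hg.inner aestronglyMeasurable_const)
      (Eventually.of_forall fun x => by
        rw [mul_comm]; exact norm_inner_le_norm _ _)
  set u : E → ℝ := fun x => inner ℝ (g x) t with hu_def
  have hu1 : Integrable u ν := hu.integrable one_le_two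
  have hu2 : Integrable (fun x => u x ^ 2) ν := hu.integrable_sq
  have hexp : Integrable (fun x => Complex.exp (Complex.I * (a * u x : ℝ))) ν := by
    refine Integrable.of_bound ?_ 1 (Eventually.of_forall fun x =>
      (Complex.norm_exp_I_mul_ofReal _).le)
    exact (by fun_prop : Continuous fun y : ℝ =>
      Complex.exp (Complex.I * (a * y : ℝ))).comp_aestronglyMeasurable hu1.1
  have hind : Integrable ({x | M < ‖g x‖ ^ 2}.indicator fun x => ‖g x‖ ^ 2) ν :=
    hg2.indicator₀ (nullMeasurableSet_lt aemeasurable_const hg2.1.aemeasurable)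
  have key : (N : ℂ) * (∫ x, Complex.exp (Complex.I * (a * u x : ℝ)) ∂ν - 1)
        + ((∫ x, u x ^ 2 ∂ν : ℝ) : ℂ) / 2
      = ∫ x, (N : ℂ) * (Complex.exp (Complex.I * (a * u x : ℝ))
          - (1 + Complex.I * (a * u x : ℝ) - ((a * u x : ℝ) : ℂ) ^ 2 / 2)) ∂ν := by
    have e : ∀ x, (N : ℂ) * (Complex.exp (Complex.I * (a * u x : ℝ))
          - (1 + Complex.I * (a * u x : ℝ) - ((a * u x : ℝ) : ℂ) ^ 2 / 2))
        = (N : ℂ) * (Complex.exp (Complex.I * (a * u x : ℝ)) - 1)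
          - (N * Complex.I * a) * (u x : ℝ) + ((u x ^ 2 : ℝ) : ℂ) / 2 := by
      intro x
      have : (N : ℂ) * (a : ℂ) ^ 2 = 1 := by exact_mod_cast haN
      push_cast
      linear_combination ((u x : ℂ) ^ 2 / 2) * this
    simp_rw [e]
    rw [integral_add, integral_sub, integral_const_mul, integral_const_mul, integral_div,
      integral_sub hexp (integrable_const _), integral_complex_ofReal, integral_complex_ofReal,
      show ∫ x, u x ∂ν = 0 from hg0]
    · simp
    · exact (hexp.sub (integrable_const _)).const_mul _
    · exact hu1.ofReal.const_mul _
    · exact ((hexp.sub (integrable_const _)).const_mul _).sub (hu1.ofReal.const_mul _)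
    · exact hu2.ofReal.div_const _
  rw [key]
  have hb : Integrable (fun x => 4 * ‖t‖ ^ 2 *
      {x | M < ‖g x‖ ^ 2}.indicator (fun x => ‖g x‖ ^ 2) x
      + 4 * ‖t‖ ^ 3 * √M ^ 3 * a) ν := (hind.const_mul _).add (integrable_const _)
  refine (norm_integral_le_of_norm_le hb (Eventually.of_forall fun x => ?_)).trans_eq ?_
  · obtain ⟨h2, h3⟩ := norm_exp_I_mul_sub_taylor_le_sq_and_cube (a * u x)
    have hux : |u x| ≤ ‖g x‖ * ‖t‖ := abs_real_inner_le_norm _ _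
    rw [norm_mul, Complex.norm_natCast]
    by_cases hx : M < ‖g x‖ ^ 2
    · rw [Set.indicator_of_mem (by exact hx)]
      calc (N : ℝ) * _ ≤ N * (4 * (a * u x) ^ 2) := by gcongr
        _ = 4 * |u x| ^ 2 := by rw [sq_abs]; linear_combination 4 * u x ^ 2 * haN
        _ ≤ 4 * (‖g x‖ * ‖t‖) ^ 2 := by gcongr
        _ = 4 * ‖t‖ ^ 2 * ‖g x‖ ^ 2 := by ring
        _ ≤ _ := le_add_of_nonneg_right (by positivity)
    · rw [Set.indicator_of_notMem (by exact hx), mul_zero, zero_add]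
      have hgM : ‖g x‖ ≤ √M := Real.le_sqrt_of_sq_le (not_lt.1 hx)
      calc (N : ℝ) * _ ≤ N * (4 * |a * u x| ^ 3) := by gcongr
        _ = 4 * |u x| ^ 3 * a := by
          rw [abs_mul, abs_of_pos ha0]; linear_combination 4 * |u x| ^ 3 * a * haN
        _ ≤ 4 * (√M * ‖t‖) ^ 3 * a := by
          gcongr
          exact hux.trans (by gcongr)
        _ = _ := by ring
  · rw [integral_add (hind.const_mul _) (integrable_const _), integral_const_mul]
    simp

lemma norm_pow_sub_pow_le_mul {a b : ℂ} (ha : ‖a‖ ≤ 1) (hb : ‖b‖ ≤ 1) (n : ℕ) :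
    ‖a ^ n - b ^ n‖ ≤ n * ‖a - b‖ := by
  induction n with
  | zero => simp
  | succ n ih =>
    have e : a ^ (n + 1) - b ^ (n + 1) = a * (a ^ n - b ^ n) + (a - b) * b ^ n := by ring
    rw [e]
    refine (norm_add_le _ _).trans ?_
    rw [norm_mul, norm_mul, norm_pow]
    have h1 : ‖a‖ * ‖a ^ n - b ^ n‖ ≤ n * ‖a - b‖ :=
      (mul_le_of_le_one_left (norm_nonneg _) ha).trans ih
    have h2 : ‖a - b‖ * ‖b‖ ^ n ≤ ‖a - b‖ :=
      mul_le_of_le_one_right (norm_nonneg _) (pow_le_one₀ (norm_nonneg _) hb)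
    push_cast
    linarith

/-- If `N (φ - 1) → -q / 2` and `N → ∞` along a filter, with `‖φ‖ ≤ 1` and `q ≥ 0`, then
`φ ^ N → exp (-q / 2)`. -/
lemma tendsto_pow_exp_of_tendsto_mul_sub_one {P : Type*} {F : Filter P} {N : P → ℕ}
    (hN : Tendsto N F atTop) {φ : P → ℂ} (hφ : ∀ p, ‖φ p‖ ≤ 1) {q : ℝ} (hq : 0 ≤ q)
    (h : Tendsto (fun p => (N p : ℂ) * (φ p - 1)) F (𝓝 (-(q : ℂ) / 2))) :
    Tendsto (fun p => φ p ^ N p) F (𝓝 (Complex.exp (-(q : ℂ) / 2))) := by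
  -- The limit is the `N`-th power of `exp (-q / (2 N))`, and this base has the same first order
  -- behaviour as `φ`, by the derivative of `exp` at zero.
  have hexp : Tendsto (fun p => (N p : ℂ) * (Complex.exp ((-(q : ℂ) / 2) / N p) - 1)) F
      (𝓝 (-(q : ℂ) / 2)) := by
    have hd : HasDerivAt (fun s : ℝ => Complex.exp ((-(q : ℂ) / 2) * s)) (-(q : ℂ) / 2) 0 := by
      have := ((Complex.ofRealCLM.hasDerivAt (x := (0 : ℝ))).const_mul (-(q : ℂ) / 2)).cexp
      simpa using this
    have hs := hd.tendsto_slope_zero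
    have hinv : Tendsto (fun p => ((N p : ℝ))⁻¹) F (𝓝[≠] 0) := by
      refine tendsto_nhdsWithin_iff.2 ⟨tendsto_inv_atTop_zero.comp
        (tendsto_natCast_atTop_atTop.comp hN), ?_⟩
      filter_upwards [hN.eventually_gt_atTop 0] with p hp
      have : (N p : ℝ) ≠ 0 := by exact_mod_cast hp.ne'
      exact inv_ne_zero this
    refine (hs.comp hinv).congr fun p => ?_
    simp [div_eq_mul_inv]
  have hdiff := h.sub hexp
  rw [sub_self] at hdiff
  -- Since `q ≥ 0`, both bases lie in the unit disc, so their `N`-th powers differ by at most `N`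
  -- times their difference; no complex logarithm is needed.
  have hlim : Tendsto (fun p => φ p ^ N p - Complex.exp (-(q : ℂ) / 2)) F (𝓝 0) := by
    refine squeeze_zero_norm' ?_ (tendsto_zero_iff_norm_tendsto_zero.1 hdiff)
    filter_upwards [hN.eventually_gt_atTop 0] with p hp
    have hp' : (N p : ℂ) ≠ 0 := by exact_mod_cast hp.ne'
    have e : Complex.exp (-(q : ℂ) / 2) = Complex.exp ((-(q : ℂ) / 2) / N p) ^ N p := by
      rw [← Complex.exp_nat_mul, mul_div_cancel₀ _ hp']
    have hb : ‖Complex.exp ((-(q : ℂ) / 2) / N p)‖ ≤ 1 := by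
      have : (-(q : ℂ) / 2) / N p = ((-q / 2 / N p : ℝ) : ℂ) := by push_cast; rfl
      rw [this, Complex.norm_exp_ofReal, Real.exp_le_one_iff]
      exact div_nonpos_of_nonpos_of_nonneg (by linarith) (Nat.cast_nonneg _)
    rw [e]
    refine (norm_pow_sub_pow_le_mul (hφ p) hb _).trans_eq ?_
    rw [← mul_sub, norm_mul, Complex.norm_natCast]
    congr 2
    ring
  simpa using hlim.add_const (Complex.exp (-(q : ℂ) / 2))

/-! ### Uniform integrability and second moments -/

section SecondMoment

variable {S E : Type*} [MeasurableSpace E] {Q : S → Measure E} {B : Set S}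

lemma UniformlyIntegrableOver.exists_integral_tail_le {V : Type*} [NormedAddCommGroup V]
    [∀ v, IsFiniteMeasure (Q v)] {r : S → E → V}
    (hr : ∀ v, AEStronglyMeasurable (r v) (Q v))
    (hUI : UniformlyIntegrableOver Q (fun v x => ‖r v x‖ ^ 2) B) {ε : ℝ} (hε : 0 < ε) :
    ∃ M : ℝ, ∀ v ∈ B, Integrable (fun x => ‖r v x‖ ^ 2) (Q v) ∧
      ∫ x, {x | M < ‖r v x‖ ^ 2}.indicator (fun x => ‖r v x‖ ^ 2) x ∂Q v ≤ ε := by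
  have h := (hUI.eventually (ge_mem_nhds (ENNReal.ofReal_pos.2 hε))).exists
  obtain ⟨M, hM⟩ := h
  refine ⟨M, fun v hv => ?_⟩
  have htail : ∫⁻ x, ENNReal.ofReal ({x | M < ‖r v x‖ ^ 2}.indicator (fun x => ‖r v x‖ ^ 2) x) ∂Q v
      ≤ ENNReal.ofReal ε := by
    refine le_trans (le_of_eq ?_) ((le_iSup₂ (f := fun b _ => tailMean Q _ b M) v hv).trans hM)
    refine lintegral_congr fun x => ?_
    by_cases hx : M < ‖r v x‖ ^ 2 <;> simp [Set.indicator, hx]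
  have hsq : AEStronglyMeasurable (fun x => ‖r v x‖ ^ 2) (Q v) := (hr v).norm.pow 2
  have hns : NullMeasurableSet {x | M < ‖r v x‖ ^ 2} (Q v) :=
    nullMeasurableSet_lt aemeasurable_const hsq.aemeasurable
  have hnn : 0 ≤ᵐ[Q v] {x | M < ‖r v x‖ ^ 2}.indicator fun x => ‖r v x‖ ^ 2 :=
    Eventually.of_forall fun x => Set.indicator_nonneg (fun _ _ => by positivity) x
  have hind : Integrable ({x | M < ‖r v x‖ ^ 2}.indicator fun x => ‖r v x‖ ^ 2) (Q v) :=
    ⟨hsq.indicator₀ hns, (hasFiniteIntegral_iff_ofReal hnn).2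
      (htail.trans_lt ENNReal.ofReal_lt_top)⟩
  -- The square is at most its tail plus `|M|`.
  refine ⟨(hind.add (integrable_const |M|)).mono' hsq (Eventually.of_forall fun x => ?_), ?_⟩
  · rw [Real.norm_of_nonneg (by positivity), Pi.add_apply]
    by_cases hx : M < ‖r v x‖ ^ 2
    · rw [Set.indicator_of_mem (by exact hx)]
      linarith [abs_nonneg M]
    · rw [Set.indicator_of_notMem (by exact hx), zero_add]
      exact (not_lt.1 hx).trans (le_abs_self M)
  · rw [integral_eq_lintegral_of_nonneg_ae hnn hind.1]
    exact ENNReal.toReal_le_of_le_ofReal hε.le htail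

variable {m : ℕ} {r : S → E → EuclideanSpace ℝ (Fin m)} {v : S}

lemma integrable_apply_mul_apply (hr : AEStronglyMeasurable (r v) (Q v))
    (h2 : Integrable (fun x => ‖r v x‖ ^ 2) (Q v)) (i j : Fin m) :
    Integrable (fun x => r v x i * r v x j) (Q v) := by
  have h : ∀ i, MemLp (fun x => r v x i) 2 (Q v) := fun i =>
    ((memLp_two_iff_integrable_sq_norm hr).2 h2).of_le
      ((by fun_prop : Continuous fun y : EuclideanSpace ℝ (Fin m) => y i).comp_aestronglyMeasurable
        hr) (Eventually.of_forall fun x => PiLp.norm_apply_le _ i)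
  exact (h i).integrable_mul (h j)

lemma dotProduct_secondMomentMatrix_mulVec (hr : AEStronglyMeasurable (r v) (Q v))
    (h2 : Integrable (fun x => ‖r v x‖ ^ 2) (Q v)) (t : EuclideanSpace ℝ (Fin m)) :
    t.ofLp ⬝ᵥ (secondMomentMatrix Q r v).mulVec t.ofLp = ∫ x, (inner ℝ (r v x) t) ^ 2 ∂Q v := by
  have hij := integrable_apply_mul_apply hr h2
  have e : ∀ x, (inner ℝ (r v x) t) ^ 2 = ∑ i, ∑ j, t i * t j * (r v x i * r v x j) := by
    intro x
    rw [PiLp.inner_apply, sq, Finset.sum_mul_sum]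
    refine Finset.sum_congr rfl fun i _ => Finset.sum_congr rfl fun j _ => ?_
    simp
    ring
  simp_rw [e]
  rw [integral_finsetSum _ fun i _ => integrable_finsetSum _ fun j _ => (hij i j).const_mul _]
  simp_rw [integral_finsetSum _ fun j _ => (hij _ j).const_mul _, integral_const_mul]
  simp only [dotProduct, Matrix.mulVec, secondMomentMatrix, Matrix.of_apply, Finset.mul_sum]
  exact Finset.sum_congr rfl fun i _ => Finset.sum_congr rfl fun j _ => by ring

lemma posSemidef_secondMomentMatrix (hr : AEStronglyMeasurable (r v) (Q v))
    (h2 : Integrable (fun x => ‖r v x‖ ^ 2) (Q v)) : (secondMomentMatrix Q r v).PosSemidef := by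
  refine Matrix.PosSemidef.of_dotProduct_mulVec_nonneg ?_ fun t => ?_
  · ext i j
    simp [secondMomentMatrix, mul_comm]
  · have := dotProduct_secondMomentMatrix_mulVec hr h2 (WithLp.toLp 2 t)
    rw [star_trivial]
    exact this ▸ integral_nonneg fun x => sq_nonneg _

/-- The characteristic functions of normalized sums of `N` independent copies of `r v`, under
`Q v`, converge to the Gaussian one as `N → ∞` and `v → s` jointly. -/
lemma tendsto_integral_exp_pow [TopologicalSpace S] [∀ v, IsProbabilityMeasure (Q v)]
    (hr : ∀ v, AEStronglyMeasurable (r v) (Q v))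
    (hr0 : ∀ v, Integrable (r v) (Q v) ∧ ∫ x, r v x ∂Q v = 0) {n : ℕ → ℕ}
    (hn : Tendsto n atTop atTop) {s : S} (hB : B ∈ 𝓝 s)
    (hUI : UniformlyIntegrableOver Q (fun v x => ‖r v x‖ ^ 2) B)
    (hcont : ContinuousWithinAt (secondMomentMatrix Q r) B s) (t : EuclideanSpace ℝ (Fin m)) :
    Tendsto (fun p : ℕ × S =>
        (∫ x, Complex.exp (Complex.I * ((√(n p.1))⁻¹ * inner ℝ (r p.2 x) t : ℝ)) ∂Q p.2) ^ n p.1)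
      (atTop ×ˢ 𝓝 s)
      (𝓝 (Complex.exp (-((t.ofLp ⬝ᵥ (secondMomentMatrix Q r s).mulVec t.ofLp : ℝ) : ℂ) / 2))) := by
  obtain ⟨_, hM1⟩ := hUI.exists_integral_tail_le hr one_pos
  have hnp : Tendsto (fun p : ℕ × S => n p.1) (atTop ×ˢ 𝓝 s) atTop := hn.comp tendsto_fst
  have hBp : ∀ᶠ p : ℕ × S in atTop ×ˢ 𝓝 s, p.2 ∈ B := tendsto_snd.eventually hB
  have hq : Tendsto (fun p : ℕ × S => ∫ x, (inner ℝ (r p.2 x) t) ^ 2 ∂Q p.2) (atTop ×ˢ 𝓝 s)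
      (𝓝 (t.ofLp ⬝ᵥ (secondMomentMatrix Q r s).mulVec t.ofLp)) := by
    have hc : Continuous fun A : Matrix (Fin m) (Fin m) ℝ => t.ofLp ⬝ᵥ A.mulVec t.ofLp := by
      fun_prop
    refine ((hc.tendsto _).comp ((hcont.continuousAt hB).tendsto.comp tendsto_snd)).congr' ?_
    filter_upwards [hBp] with p hp
    exact dotProduct_secondMomentMatrix_mulVec (hr _) (hM1 _ hp).1 t
  refine tendsto_pow_exp_of_tendsto_mul_sub_one hnp (fun p => ?_) ?_ ?_
  · refine (norm_integral_le_of_norm_le (integrable_const (1 : ℝ))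
      (Eventually.of_forall fun x => (Complex.norm_exp_I_mul_ofReal _).le)).trans_eq ?_
    simp
  · rw [dotProduct_secondMomentMatrix_mulVec (hr _) (hM1 _ (mem_of_mem_nhds hB)).1]
    exact integral_nonneg fun x => sq_nonneg _
  · have hrem : Tendsto (fun p : ℕ × S => (n p.1 : ℂ) *
          (∫ x, Complex.exp (Complex.I * ((√(n p.1))⁻¹ * inner ℝ (r p.2 x) t : ℝ)) ∂Q p.2 - 1)
          + ((∫ x, (inner ℝ (r p.2 x) t) ^ 2 ∂Q p.2 : ℝ) : ℂ) / 2) (atTop ×ˢ 𝓝 s) (𝓝 0) := by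
      refine Metric.tendsto_nhds.2 fun ε hε => ?_
      -- `M` is fixed first, making the tail term at most `ε / 2` uniformly on `B`; then large `n`
      -- handles the cubic term. The `+ 1` covers `t = 0`.
      have hδ : 0 < ε / (2 * (4 * ‖t‖ ^ 2 + 1)) := by positivity
      obtain ⟨M, hM⟩ := hUI.exists_integral_tail_le hr hδ
      have hsmall : Tendsto (fun p : ℕ × S => 4 * ‖t‖ ^ 3 * √M ^ 3 * (√(n p.1))⁻¹)
          (atTop ×ˢ 𝓝 s) (𝓝 0) := by
        have := (tendsto_inv_atTop_zero.comp (Real.tendsto_sqrt_atTop.comp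
          (tendsto_natCast_atTop_atTop.comp hnp))).const_mul (4 * ‖t‖ ^ 3 * √M ^ 3)
        simpa using this
      filter_upwards [hBp, hnp.eventually_gt_atTop 0,
        hsmall.eventually (gt_mem_nhds (half_pos hε))] with p hp hp0 hp1
      rw [dist_zero_right]
      have hmean : ∫ x, inner ℝ (r p.2 x) t ∂Q p.2 = 0 := by
        simp_rw [real_inner_comm t]
        rw [integral_inner (hr0 _).1, (hr0 _).2, inner_zero_right]
      refine (norm_integral_exp_sub_taylor_le (Q p.2) (hr _) (hM _ hp).1 t hmean (M := M)
        hp0).trans_lt ?_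
      have h1 : 4 * ‖t‖ ^ 2 * ∫ x, {x | M < ‖r p.2 x‖ ^ 2}.indicator
          (fun x => ‖r p.2 x‖ ^ 2) x ∂Q p.2 ≤ ε / 2 := by
        calc _ ≤ 4 * ‖t‖ ^ 2 * (ε / (2 * (4 * ‖t‖ ^ 2 + 1))) := by
              gcongr
              exact (hM _ hp).2
          _ ≤ (4 * ‖t‖ ^ 2 + 1) * (ε / (2 * (4 * ‖t‖ ^ 2 + 1))) := by
              gcongr
              linarith
          _ = ε / 2 := by field_simp
      linarith
    have hq2 := ((Complex.continuous_ofReal.tendsto _).comp hq).div_const 2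
    have := hrem.sub hq2
    rw [zero_sub, ← neg_div] at this
    refine this.congr fun p => ?_
    simp

end SecondMoment

/-! ### From deterministic parameters to random ones. -/

/-- For large `k`, `G k` is within `ε / 2` of `c` on a ball around `s`. Off the ball the distance is
at most `2`, on an event of probability below `ε / 4`. -/
lemma MeasureTheory.TendstoInMeasure.tendsto_integral_comp {Ω S : Type*} [MeasurableSpace Ω]
    {μ : Measure Ω} [IsProbabilityMeasure μ] [PseudoMetricSpace S] [MeasurableSpace S]
    [OpensMeasurableSpace S] {b : ℕ → Ω → S} (hb : ∀ k, Measurable (b k)) {s : S}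
    (hconv : TendstoInMeasure μ b atTop fun _ => s) {G : ℕ → S → ℂ} (hG1 : ∀ k v, ‖G k v‖ ≤ 1)
    (hGm : ∀ᶠ k in atTop, AEStronglyMeasurable (fun ω => G k (b k ω)) μ) {c : ℂ}
    (hG : Tendsto (fun p : ℕ × S => G p.1 p.2) (atTop ×ˢ 𝓝 s) (𝓝 c)) :
    Tendsto (fun k => ∫ ω, G k (b k ω) ∂μ) atTop (𝓝 c) := by
  have hc : ‖c‖ ≤ 1 := le_of_tendsto hG.norm (Eventually.of_forall fun p => hG1 _ _)
  refine Metric.tendsto_nhds.2 fun ε hε => ?_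
  obtain ⟨pa, hpa, pb, hpb, hab⟩ := eventually_prod_iff.1
    (Metric.tendsto_nhds.1 hG (ε / 2) (half_pos hε))
  obtain ⟨δ, hδ, hball⟩ := Metric.nhds_basis_eball.eventually_iff.1 hpb
  have hbad := (ENNReal.tendsto_toReal ENNReal.zero_ne_top).comp (hconv δ hδ)
  rw [ENNReal.toReal_zero] at hbad
  filter_upwards [hpa, hGm, hbad.eventually (gt_mem_nhds (by positivity : 0 < ε / 4))]
    with k hk hkm hkb
  have hset : MeasurableSet {ω | δ ≤ edist (b k ω) s} :=
    measurableSet_le measurable_const (measurable_edist_left.comp (hb k))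
  have hint : Integrable (fun ω => G k (b k ω)) μ :=
    Integrable.of_bound hkm 1 (Eventually.of_forall fun ω => hG1 _ _)
  have hsub : ∫ ω, G k (b k ω) ∂μ - c = ∫ ω, (G k (b k ω) - c) ∂μ := by
    rw [integral_sub hint (integrable_const _)]
    simp
  have hbi : Integrable ({ω | δ ≤ edist (b k ω) s}.indicator fun _ => (2 : ℝ)) μ :=
    (integrable_const _).indicator hset
  rw [dist_eq_norm, hsub]
  refine (norm_integral_le_of_norm_le ((integrable_const (ε / 2)).add hbi)
    (Eventually.of_forall fun ω => ?_)).trans_lt ?_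
  · rw [Pi.add_apply]
    by_cases hω : δ ≤ edist (b k ω) s
    · rw [Set.indicator_of_mem (by exact hω)]
      linarith [norm_sub_le (G k (b k ω)) c, hG1 k (b k ω)]
    · rw [Set.indicator_of_notMem (by exact hω), add_zero]
      have := hab hk (hball (x := b k ω) (by simpa using hω))
      rw [dist_eq_norm] at this
      exact this.le
  · have e : ∫ ω, ((fun _ : Ω => ε / 2) + {ω | δ ≤ edist (b k ω) s}.indicator fun _ => (2 : ℝ)) ω ∂μ
        = ε / 2 + μ.real {ω | δ ≤ edist (b k ω) s} * 2 := by
      rw [integral_add' (integrable_const _) hbi, integral_indicator hset]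
      simp
    rw [e]
    simp only [Function.comp_apply] at hkb
    simp only [Measure.real]
    linarith

theorem mainTheorem9 {l m : ℕ}
    -- the parameter set, the measurable space of samples, the family of distributions
    (A : Set (EuclideanSpace ℝ (Fin l))) (hA : MeasurableSet A)
    {Ω₁ : Type*} [MeasurableSpace Ω₁]
    (Q : A → Measure Ω₁) (hQ : ∀ v, IsProbabilityMeasure (Q v))
    -- the function `r`, measurable on the product and centred under each `Q v`
    (r : A → Ω₁ → EuclideanSpace ℝ (Fin m))
    (hr : Measurable (fun p : A × Ω₁ => r p.1 p.2))
    (hr0 : ∀ v, Integrable (r v) (Q v) ∧ ∫ x, r v x ∂(Q v) = 0)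
    -- the random variables of the multi-stage scheme
    {Ω : Type*} [MeasurableSpace Ω] (μ : Measure Ω) [IsProbabilityMeasure μ]
    (b : ℕ → Ω → A) (hb : ∀ k, Measurable (b k))
    (n : ℕ → ℕ) (χ : (k : ℕ) → Fin (n k) → Ω → Ω₁) (hχ : ∀ k i, Measurable (χ k i))
    (hχb : MultiStageSample μ Q b n χ)
    -- the assumptions of the limit theorem
    (hn : Tendsto n atTop atTop)
    (bstar : A) (B : Set A) (hBmeas : MeasurableSet B) (hB : B ∈ 𝓝 bstar)
    (hconv : TendstoInMeasure μ b atTop (fun _ => bstar))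
    (hUI : UniformlyIntegrableOver Q (fun v x => ‖r v x‖ ^ 2) B)
    (hcont : ContinuousWithinAt (secondMomentMatrix Q r) B bstar) :
    TendstoInDistribution
      (fun (k : ℕ) (ω : Ω) =>
        (Real.sqrt (n (k + 1)))⁻¹ • ∑ i : Fin (n (k + 1)), r (b k ω) (χ (k + 1) i ω))
      atTop id (fun _ => μ) (multivariateGaussian 0 (secondMomentMatrix Q r bstar)) := by
  have hrv : ∀ v, Measurable (r v) := fun v => hr.comp measurable_prodMk_left
  have hrs : ∀ v, AEStronglyMeasurable (r v) (Q v) := fun v => (hrv v).aestronglyMeasurable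
  have hn1 : Tendsto (fun k => n (k + 1)) atTop atTop := hn.comp (tendsto_add_atTop_nat 1)
  have hXm : ∀ k, Measurable fun ω =>
      (√(n (k + 1)))⁻¹ • ∑ i : Fin (n (k + 1)), r (b k ω) (χ (k + 1) i ω) := fun k =>
    (measurable_const_smul _).comp
      (Finset.measurable_fun_sum _ fun i _ => hr.comp ((hb k).prodMk (hχ (k + 1) i)))
  have hpsd := posSemidef_secondMomentMatrix (hrs bstar)
    ((hUI.exists_integral_tail_le hrs one_pos).choose_spec _ (mem_of_mem_nhds hB)).1
  -- Measurability of the random law is read off a sample variable, so the stage must be nonempty;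
  -- this holds for large `k`.
  have hlaw0 : ∀ᶠ k in atTop, Measurable fun ω => Q (b k ω) := by
    filter_upwards [hn1.eventually_gt_atTop 0] with k hk
    exact (hχb.condLaw k ⟨0, hk⟩).measurable_law.mono (hb k).comap_le le_rfl
  refine ⟨fun k => (hXm k).aemeasurable, aemeasurable_id, ?_⟩
  refine ProbabilityMeasure.tendsto_iff_tendsto_charFun.2 fun t => ?_
  let f : ℕ → A → Ω₁ → ℂ := fun k v x =>
    Complex.exp (Complex.I * ((√(n (k + 1)))⁻¹ * inner ℝ (r v x) t : ℝ))
  have hfm : ∀ k, Measurable fun p : A × Ω₁ => f k p.1 p.2 := fun k =>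
    (by fun_prop : Continuous fun y : EuclideanSpace ℝ (Fin m) =>
      Complex.exp (Complex.I * ((√(n (k + 1)))⁻¹ * inner ℝ y t : ℝ))).measurable.comp hr
  have hf1 : ∀ k v x, ‖f k v x‖ ≤ 1 := fun k v x => (Complex.norm_exp_I_mul_ofReal _).le
  have hlim : Tendsto (fun k => ∫ ω, (∫ x, f k (b k ω) x ∂Q (b k ω)) ^ n (k + 1) ∂μ) atTop
      (𝓝 (Complex.exp
        (-((t.ofLp ⬝ᵥ (secondMomentMatrix Q r bstar).mulVec t.ofLp : ℝ) : ℂ) / 2))) := by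
    refine hconv.tendsto_integral_comp hb
      (G := fun k v => (∫ x, f k v x ∂Q v) ^ n (k + 1)) (fun k v => ?_) ?_
      (tendsto_integral_exp_pow hrs hr0 hn1 hB hUI hcont t)
    · rw [norm_pow]
      refine pow_le_one₀ (norm_nonneg _) ?_
      refine (norm_integral_le_of_norm_le (integrable_const (1 : ℝ))
        (Eventually.of_forall fun x => hf1 k v x)).trans_eq ?_
      simp
    · filter_upwards [hlaw0] with k hk
      exact (measurable_integral_comp_pow (hb k) hk (hfm k) _).aestronglyMeasurable
  have hmap : (multivariateGaussian 0 (secondMomentMatrix Q r bstar)).map id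
      = multivariateGaussian 0 (secondMomentMatrix Q r bstar) := Measure.map_id
  simp only [ProbabilityMeasure.coe_mk, hmap, charFun_multivariateGaussian hpsd]
  convert! hlim.congr' ?_ using 2
  · simp [neg_div]
  filter_upwards [hlaw0] with k hk
  have hprod := (hχb.condIndep k).integral_prod_eq (hb k) (hχ (k + 1)) hk (hχb.condLaw k)
    (hfm k) (hf1 k)
  rw [Fintype.card_fin] at hprod
  rw [← hprod, charFun_apply, integral_map (hXm k).aemeasurable (by fun_prop)]
  refine integral_congr_ae (Eventually.of_forall fun ω => ?_)
  -- The exponential of the sum over the stage is the product of the factors `f k`.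
  simp only [f]
  rw [← Complex.exp_sum, ← Finset.mul_sum, ← Complex.ofReal_sum, ← Finset.mul_sum,
    real_inner_smul_left, sum_inner, mul_comm Complex.I]
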